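/- Let $\mathbb{K}$ be an arbitrary field, let $U$ be a finite-dimensional vector space over $\mathbb{K}$, and let $V$ be a linear subspace of $U$, with dual space $V^\star$. Denote by $\mathcal{L}_a(U,V^\star)$ the vector space of all linear maps $f : U \to V^\star$ that are alternating, i.e. such that $f(x)[x]=0$ for all $x \in V$, and by $\mathcal{L}_a(V,V^\star)$ the space of all linear maps $f : V \to V^\star$ such that $f(x)[x]=0$ for all $x\in V$. Let $\mathcal{S}$ be a linear subspace of $\mathcal{L}_a(U,V^\star)$, and set $\mathcal{S}_r := \{ f_{|V} \mid f \in \mathcal{S}\}$, which is a linear subspace of $\mathcal{L}_a(V,V^\star)$. Assume that the codimension of $\mathcal{S}$ in $\mathcal{L}_a(U,V^\star)$ is at most $\dim V-2$, and that the codimension of $\mathcal{S}_r$ in $\mathcal{L}_a(V,V^\star)$ is at most $\dim V-3$. Then every range-compatible group homomorphism $F : \mathcal{S} \to V^\star$ is local. That is, if $F$ is an additive map such that $F(s)$ belongs to the range of $s$ for every $s \in \mathcal{S}$, then there exists a vector $x \in U$ such that $F(s)=s(x)$ for all $s \in \mathcal{S}$. -/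

import Mathlib

/-- A map `F : S → W` on a linear subspace `S` of `L(U, W)` is range-compatible when
`F s` belongs to the range of `s` for every `s ∈ S`. -/
def IsRangeCompatible {K U W : Type*} [Field K] [AddCommGroup U] [Module K U]
    [AddCommGroup W] [Module K W] (S : Submodule K (U →ₗ[K] W)) (F : S → W) : Prop :=
  ∀ s : S, F s ∈ LinearMap.range (s : U →ₗ[K] W)

/-- A map `F : S → W` on a linear subspace `S` of `L(U, W)` is local when it is the evaluation
`s ↦ s x` at some fixed vector `x` of `U`. -/
def IsLocalMap {K U W : Type*} [Field K] [AddCommGroup U] [Module K U]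
    [AddCommGroup W] [Module K W] (S : Submodule K (U →ₗ[K] W)) (F : S → W) : Prop :=
  ∃ x : U, ∀ s : S, F s = (s : U →ₗ[K] W) x

/-- The codimension of `A` in `B` (used for linear subspaces `A ≤ B` of `L(U, W)`): the dimension
of `B / A`. -/
noncomputable def relCodim {K U W : Type*} [Field K] [AddCommGroup U] [Module K U]
    [AddCommGroup W] [Module K W] (A B : Submodule K (U →ₗ[K] W)) : ℕ :=
  Module.finrank K (B ⧸ A.submoduleOf B)

/-- The space `L_a(U, V*)` of alternating operators, for a linear subspace `V` of `U`: the linear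
maps `f : U → V*` such that `f(x)[x] = 0` for all `x ∈ V`. -/
def alternatingOperators {K U : Type*} [Field K] [AddCommGroup U] [Module K U]
    (V : Submodule K U) : Submodule K (U →ₗ[K] Module.Dual K V) where
  carrier := {f | ∀ x : V, f (x : U) x = 0}
  zero_mem' := by intro x; simp
  add_mem' := by
    intro f g hf hg x
    simp [hf x, hg x]
  smul_mem' := by
    intro c f hf x
    simp [hf x]

/-- The space `L_a(V, V*)` of linear maps `f : V → V*` such that `f(x)[x] = 0` for all `x ∈ V`. -/
def alternatingForms (K V : Type*) [Field K] [AddCommGroup V] [Module K V] :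
    Submodule K (V →ₗ[K] Module.Dual K V) where
  carrier := {f | ∀ x : V, f x x = 0}
  zero_mem' := by intro x; simp
  add_mem' := by
    intro f g hf hg x
    simp [hf x, hg x]
  smul_mem' := by
    intro c f hf x
    simp [hf x]

/-- The restricted space `S_r = {f|_V : f ∈ S}`, a linear subspace of `L(V, V*)`. -/
def restrictedSpace {K U : Type*} [Field K] [AddCommGroup U] [Module K U]
    (V : Submodule K U) (S : Submodule K (U →ₗ[K] Module.Dual K V)) :
    Submodule K (V →ₗ[K] Module.Dual K V) :=
  S.map (LinearMap.lcomp K (Module.Dual K V) V.subtype)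

theorem restrictedSpace_le {K U : Type*} [Field K] [AddCommGroup U] [Module K U]
    (V : Submodule K U) (S : Submodule K (U →ₗ[K] Module.Dual K V))
    (hS : S ≤ alternatingOperators V) : restrictedSpace V S ≤ alternatingForms K V := by
  rintro _ ⟨f, hf, rfl⟩ x
  exact hS hf x

/-! The proof is by induction on `dim V`. For the quotients to stay in the same class, `V ≤ U` is
replaced by an injection `j : V → U`, and `V*` by a space `Y` with an isomorphism `e : Y ≃ V*`.
Dividing `Y` by a line `K y` then replaces `V` by the hyperplane `ker (e y)`. Inductive step (`dim V
≥ 4`): both codimension bounds survive the quotient by `y` unless a bound is sharp and `y` lies in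
an exceptional proper subspace. So there are independent `y` and `z` modulo which `F` is local, say
at `x` and `x'`. After subtracting evaluation at `x`, `F` takes values in `K y` and agrees with
evaluation at `x' - x` modulo `z`; hence `s (x' - x)` lies in `span {y, z}` for all `s`. If `x' - x`
is outside `V`, this makes `S` so large that range-compatibility fails
(`IsRangeCompatible.false_of_two_lines`). If it is a nonzero vector of `V`, the bound on `S_r` must
be sharp and `y` exceptional, against its choice (`mem_wedgeFiber_of_forall_apply_mem_span`). Hence
`x' = x`, and `F` is zero after the subtraction, since `K y ∩ K z = 0`. Base case (`dim V = 3`):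
`S_r` is the space of all alternating forms. On the maps of `S` vanishing on `V`, `F` is local by
the analogous theorem without alternation (`IsRangeCompatible.isLocalMap_vanishingOn`). After a
subtraction, `F` descends to the alternating forms, which the triple product identifies with `V`;
there it becomes an additive alternating map, hence linear and local. -/

open Module

/-! ### Dimension counts and avoidance of subspaces -/

section LinearAlgebra

variable {K E E' : Type*} [Field K] [AddCommGroup E] [Module K E] [AddCommGroup E'] [Module K E']

theorem finrank_map_add_finrank_inf_ker [FiniteDimensional K E] (R : E →ₗ[K] E')
    (A : Submodule K E) :
    finrank K (A.map R) + finrank K (A ⊓ LinearMap.ker R : Submodule K E) = finrank K A := by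
  have h := LinearMap.finrank_range_add_finrank_ker (R.domRestrict A)
  rw [LinearMap.range_domRestrict, LinearMap.ker_domRestrict] at h
  rw [← h]
  congr 1
  rw [inf_comm]
  exact ((LinearMap.ker R).submoduleOf A |>.equivMapOfInjective A.subtype
    A.subtype_injective |>.trans (LinearEquiv.ofEq _ _ (by
      rw [Submodule.submoduleOf, Submodule.map_comap_subtype, inf_comm]))).finrank_eq.symm

/-- A linear map does not increase codimension: the loss is the codimension of `A ⊓ ker R` in `B ⊓
ker R`. -/
theorem finrank_map_add_le [FiniteDimensional K E] (R : E →ₗ[K] E') {A B : Submodule K E}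
    (h : A ≤ B) :
    finrank K (B.map R) + finrank K A ≤ finrank K (A.map R) + finrank K B := by
  have h1 := finrank_map_add_finrank_inf_ker R A
  have h2 := finrank_map_add_finrank_inf_ker R B
  have h3 := Submodule.finrank_mono (inf_le_inf_right (LinearMap.ker R) h)
  omega

theorem finrank_map_add_lt [FiniteDimensional K E] (R : E →ₗ[K] E') {A B : Submodule K E}
    (h : A ≤ B) (hB : ¬ B ⊓ LinearMap.ker R ≤ A) :
    finrank K (B.map R) + finrank K A + 1 ≤ finrank K (A.map R) + finrank K B := by
  have h1 := finrank_map_add_finrank_inf_ker R A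
  have h2 := finrank_map_add_finrank_inf_ker R B
  have h3 : finrank K (A ⊓ LinearMap.ker R : Submodule K E) <
      finrank K (B ⊓ LinearMap.ker R : Submodule K E) := by
    apply Submodule.finrank_lt_finrank_of_lt
    refine lt_of_le_of_ne (inf_le_inf_right _ h) fun he => hB ?_
    rw [← he]
    exact inf_le_left
  omega

/-- Equality case of a codimension count: confining `R S` to `Q` already costs all the codimension
that `S` has in `L`, so `S` is the full preimage of `Q` in `L`. -/
theorem mem_of_map_mem_of_finrank_le [FiniteDimensional K E] [FiniteDimensional K E']
    (R : E →ₗ[K] E') {S L : Submodule K E}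
    {Q : Submodule K E'} (hSL : S ≤ L) (hSQ : S.map R ≤ Q)
    (h : finrank K L + finrank K Q ≤ finrank K S + finrank K (L.map R))
    {f : E} (hf : f ∈ L) (hfQ : R f ∈ Q) : f ∈ S := by
  have hSC : S ≤ L ⊓ Q.comap R := le_inf hSL (Submodule.map_le_iff_le_comap.1 hSQ)
  have h1 := finrank_map_add_finrank_inf_ker R (L ⊓ Q.comap R)
  have h2 := finrank_map_add_finrank_inf_ker R L
  have h3 : finrank K ((L ⊓ Q.comap R).map R) ≤ finrank K Q :=
    Submodule.finrank_mono (Submodule.map_le_iff_le_comap.2 inf_le_right)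
  have h4 : finrank K ((L ⊓ Q.comap R) ⊓ LinearMap.ker R : Submodule K E) ≤
      finrank K (L ⊓ LinearMap.ker R : Submodule K E) :=
    Submodule.finrank_mono (inf_le_inf_right _ inf_le_left)
  rw [Submodule.eq_of_le_of_finrank_le hSC (by omega)]
  exact ⟨hf, hfQ⟩

/-- Two proper subspaces never cover a space, even over the field with two elements, whereas three
may; later choices of vectors are arranged to avoid only two at a time. -/
theorem exists_notMem_notMem {A B : Submodule K E} (hA : A ≠ ⊤) (hB : B ≠ ⊤) :
    ∃ v, v ∉ A ∧ v ∉ B := by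
  obtain ⟨a, ha⟩ : ∃ a, a ∉ A := by
    by_contra! h
    exact hA (eq_top_iff.2 fun x _ => h x)
  obtain ⟨b, hb⟩ : ∃ b, b ∉ B := by
    by_contra! h
    exact hB (eq_top_iff.2 fun x _ => h x)
  by_cases haB : a ∈ B
  · by_cases hbA : b ∈ A
    · exact ⟨a + b, fun h => ha ((A.add_mem_iff_left hbA).1 h),
        fun h => hb ((B.add_mem_iff_right haB).1 h)⟩
    · exact ⟨b, hbA, hb⟩
  · exact ⟨a, ha, haB⟩

theorem span_singleton_sup_ne_top_of_finrank {A : Submodule K E} {y : E}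
    (h : finrank K A + 2 ≤ finrank K E) : A ⊔ K ∙ y ≠ ⊤ := by
  intro ht
  have : FiniteDimensional K E := FiniteDimensional.of_finrank_pos (by omega)
  have h1 := Submodule.finrank_add_le_finrank_add_finrank A (K ∙ y)
  have h2 : finrank K (K ∙ y) ≤ 1 := by simpa using finrank_span_le_card (R := K) ({y} : Set E)
  rw [ht, finrank_top] at h1
  omega

theorem smul_add_smul_eq_zero_of_notMem_span {y z : E} (hy : y ≠ 0) (hz : z ∉ K ∙ y) {a b : K}
    (h : a • y + b • z = 0) : a = 0 ∧ b = 0 := by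
  refine LinearIndependent.pair_iff.1 ((LinearIndependent.pair_iff' hy).2 fun c hc => ?_) a b h
  exact hz (Submodule.mem_span_singleton.2 ⟨c, hc⟩)

theorem mem_span_singleton_of_ker_le {y φ : Dual K E} (h : ∀ v, y v = 0 → φ v = 0) :
    φ ∈ K ∙ y := by
  by_cases hy : y = 0
  · have : φ = 0 := LinearMap.ext fun v => h v (by simp [hy])
    simp [this]
  · obtain ⟨e, he⟩ : ∃ e, y e ≠ 0 := by
      by_contra! h'
      exact hy (LinearMap.ext h')
    refine Submodule.mem_span_singleton.2 ⟨φ e / y e, LinearMap.ext fun v => ?_⟩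
    have := h (v - (y v / y e) • e) (by simp [he])
    simp only [map_sub, map_smul, smul_eq_mul] at this
    rw [sub_eq_zero.1 this]
    simp only [LinearMap.smul_apply, smul_eq_mul]
    ring

end LinearAlgebra

/-! ### Range-compatible homomorphisms without the alternating condition -/

section RangeCompatible

variable {K U Y Y' : Type*} [Field K] [AddCommGroup U] [Module K U] [AddCommGroup Y] [Module K Y]
  [AddCommGroup Y'] [Module K Y']

/-- A homomorphism on `S` that vanishes on the kernel of `R` descends to the image of `S`. -/
theorem exists_addMonoidHom_map {K E E' Y : Type*} [Field K] [AddCommGroup Y] [AddCommGroup E] [Module K E] [AddCommGroup E']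
    [Module K E'] (R : E →ₗ[K] E') {S : Submodule K E} (F : S →+ Y)
    (hF : ∀ s : S, R s = 0 → F s = 0) :
    ∃ F' : S.map R →+ Y, ∀ s : S, F' ⟨R s, Submodule.mem_map_of_mem s.2⟩ = F s := by
  let r : S →+ S.map R :=
    { toFun := fun s => ⟨R s, Submodule.mem_map_of_mem s.2⟩
      map_zero' := by ext; simp
      map_add' := fun s t => by ext; simp }
  have hr : Function.Surjective r := by
    rintro ⟨_, s, hs, rfl⟩
    exact ⟨⟨s, hs⟩, rfl⟩
  have hk : r.ker ≤ F.ker := fun s hs => hF s (congrArg Subtype.val hs)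
  exact ⟨AddMonoidHom.liftOfSurjective r hr ⟨_, hk⟩, fun s =>
    AddMonoidHom.liftOfRightInverse_comp_apply _ _ _ _ s⟩

/-- A range-compatible homomorphism descends along a linear map of the target space. -/
theorem IsRangeCompatible.exists_map {S : Submodule K (U →ₗ[K] Y)} {F : S →+ Y}
    (hF : IsRangeCompatible S F) (g : Y →ₗ[K] Y') :
    ∃ F' : S.map (LinearMap.compRight K (M := U) g) →+ Y', IsRangeCompatible _ F' ∧
      ∀ s : S, F' ⟨g ∘ₗ (s : U →ₗ[K] Y), Submodule.mem_map_of_mem s.2⟩ = g (F s) := by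
  obtain ⟨F', hF'⟩ := exists_addMonoidHom_map (LinearMap.compRight K (M := U) g)
    (g.toAddMonoidHom.comp F) (by
      intro s hs
      obtain ⟨u, hu⟩ := hF s
      change g (F s) = 0
      rw [← hu]
      exact LinearMap.congr_fun hs u)
  refine ⟨F', ?_, hF'⟩
  rintro ⟨_, s, hs, rfl⟩
  obtain ⟨u, hu⟩ := hF ⟨s, hs⟩
  refine ⟨u, (?_ : _ = F' _)⟩
  rw [hF' ⟨s, hs⟩]
  change g (s u) = g (F ⟨s, hs⟩)
  rw [← hu]

/-- Translating a range-compatible homomorphism by a local map. -/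
theorem IsRangeCompatible.exists_sub {S : Submodule K (U →ₗ[K] Y)} {F : S →+ Y}
    (hF : IsRangeCompatible S F) (x : U) :
    ∃ G : S →+ Y, IsRangeCompatible S G ∧ ∀ s : S, G s = F s - (s : U →ₗ[K] Y) x := by
  refine ⟨F - ((LinearMap.applyₗ x).comp S.subtype).toAddMonoidHom, fun s => ?_, fun s => rfl⟩
  obtain ⟨u, hu⟩ := hF s
  refine ⟨u - x, ?_⟩
  rw [map_sub, hu]
  rfl

/-- The space of linear maps vanishing on a subspace. -/
def vanishingOn (N : Submodule K U) (Y : Type*) [AddCommGroup Y] [Module K Y] :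
    Submodule K (U →ₗ[K] Y) where
  carrier := {f | ∀ u ∈ N, f u = 0}
  zero_mem' := by intro x; simp
  add_mem' := by
    intro f g hf hg x hx
    simp [hf x hx, hg x hx]
  smul_mem' := by
    intro c f hf x hx
    simp [hf x hx]

/-- The vectors `y` such that `S` contains all `φ ⊗ y` with `φ` vanishing on `N`. -/
def tensorFiber (N : Submodule K U) (S : Submodule K (U →ₗ[K] Y)) : Submodule K Y where
  carrier := {y | ∀ φ ∈ vanishingOn N K, φ.smulRight y ∈ S}
  zero_mem' := by
    intro φ _
    simp
  add_mem' := by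
    intro y z hy hz φ hφ
    convert S.add_mem (hy φ hφ) (hz φ hφ) using 1
    ext u
    simp
  smul_mem' := by
    intro c y hy φ hφ
    convert S.smul_mem c (hy φ hφ) using 1
    ext u
    simp [smul_comm c]

theorem vanishingOn_le_of_tensorFiber_eq_top [FiniteDimensional K Y] {N : Submodule K U}
    {S : Submodule K (U →ₗ[K] Y)} (h : tensorFiber N S = ⊤) : vanishingOn N Y ≤ S := by
  intro f hf
  let b := finBasis K Y
  have : f = ∑ i, ((b.coord i) ∘ₗ f).smulRight (b i) := by
    ext u
    simp [b.sum_repr]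
  rw [this]
  refine S.sum_mem fun i _ => ?_
  have hb : b i ∈ tensorFiber N S := h ▸ Submodule.mem_top
  exact hb _ fun u hu => by simp [hf u hu]

/-- If `S` has codimension at most `dim Y - 2` in `L` and `L` contains all `φ ⊗ w`, where
`φ x = 1`, then a range-compatible map cannot be zero modulo `y` and evaluation at `x` modulo `z`,
for independent `y` and `z`. -/
theorem IsRangeCompatible.false_of_two_lines [FiniteDimensional K U] [FiniteDimensional K Y]
    {S L : Submodule K (U →ₗ[K] Y)} (hSL : S ≤ L)
    (hdim : finrank K L + 2 ≤ finrank K S + finrank K Y) {x : U} {φ : Dual K U} (hφ : φ x = 1)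
    (hL : ∀ z : Y, φ.smulRight z ∈ L) {y z : Y} (hy : y ≠ 0) (hz : z ∉ K ∙ y)
    {F : S →+ Y} (hF : IsRangeCompatible S F) (h1 : ∀ s, F s ∈ K ∙ y)
    (h2 : ∀ s : S, F s - (s : U →ₗ[K] Y) x ∈ K ∙ z) : False := by
  -- Since `s x = F s - (F s - s x)`, evaluation at `x` maps `S` into `span {y, z}`, which has
  -- codimension at least `dim Y - 2`. So `S` contains every map of `L` sending `x` into that span.
  have hmem : φ.smulRight (y + z) ∈ S := by
    refine mem_of_map_mem_of_finrank_le (LinearMap.applyₗ x) (Q := Submodule.span K {y, z})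
      hSL ?_ ?_ (hL _) ?_
    · rintro _ ⟨s, hs, rfl⟩
      obtain ⟨a, ha⟩ := Submodule.mem_span_singleton.1 (h1 ⟨s, hs⟩)
      obtain ⟨b, hb⟩ := Submodule.mem_span_singleton.1 (h2 ⟨s, hs⟩)
      refine Submodule.mem_span_pair.2 ⟨a, -b, ?_⟩
      rw [neg_smul, ha, hb]
      simp
    · have ht : L.map (LinearMap.applyₗ x : (U →ₗ[K] Y) →ₗ[K] Y) = ⊤ :=
        eq_top_iff.2 fun w _ => ⟨_, hL w, by simp [hφ]⟩
      rw [ht, finrank_top]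
      have h3 : finrank K (Submodule.span K ({y, z} : Set Y)) ≤ 2 := by
        classical
        have := finrank_span_finset_le_card (R := K) ({y, z} : Finset Y)
        rw [Finset.coe_pair] at this
        exact this.trans Finset.card_le_two
      omega
    · exact Submodule.mem_span_pair.2 ⟨1, 1, by simp [hφ]⟩
  -- The value of `F` here lies in `K (y + z)` and in `K y`, so it is zero; then `y + z` would have
  -- to lie in `K z`.
  obtain ⟨u, hu⟩ := hF ⟨_, hmem⟩
  obtain ⟨a, ha⟩ := Submodule.mem_span_singleton.1 (h1 ⟨_, hmem⟩)
  obtain ⟨b, hb⟩ := Submodule.mem_span_singleton.1 (h2 ⟨_, hmem⟩)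
  rw [← ha] at hu hb
  simp only [LinearMap.smulRight_apply, hφ] at hu hb
  have e1 := smul_add_smul_eq_zero_of_notMem_span hy hz (a := φ u - a) (b := φ u) (by
    rw [sub_smul, ← hu]; module)
  have e2 := smul_add_smul_eq_zero_of_notMem_span hy hz (a := a - 1) (b := -1 - b) (by
    rw [sub_smul _ b, hb]; module)
  have h0 : a = 0 := by simpa [e1.2] using e1.1
  simp [h0] at e2

theorem IsRangeCompatible.isLocalMap_vanishingOn_of_finrank_eq_two [FiniteDimensional K U]
    {N : Submodule K U} (hY : finrank K Y = 2) {S : Submodule K (U →ₗ[K] Y)}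
    (hSL : S = vanishingOn N Y) {F : S →+ Y} (hF : IsRangeCompatible S F) :
    IsLocalMap S F := by
  subst hSL
  have : FiniteDimensional K Y := FiniteDimensional.of_finrank_pos (by omega)
  let b := finBasisOfFinrankEq K Y hY
  have hmem : ∀ (φ : vanishingOn N K) (y : Y), φ.1.smulRight y ∈ vanishingOn N Y := by
    intro φ y u hu
    simp [φ.2 u hu]
  let T : Y → vanishingOn N K → vanishingOn N Y := fun y φ => ⟨φ.1.smulRight y, hmem φ y⟩
  have hT : ∀ y φ, ∃ a : K, F (T y φ) = a • y := by
    intro y φ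
    obtain ⟨u, hu⟩ := hF (T y φ)
    exact ⟨_, hu.symm⟩
  have hTadd : ∀ y φ ψ, T y (φ + ψ) = T y φ + T y ψ := by
    intro y φ ψ
    ext u
    simp [T, add_smul]
  choose p hp using hT
  -- Moving `c` between the two tensor factors of `φ ⊗ (b 0 + c b 1)` turns additivity of `F` into
  -- homogeneity of `p (b 0)`.
  have hcomp : ∀ (c : K) φ, p (b 1) (c • φ) = c * p (b 0) φ := by
    intro c φ
    have h1 : T (b 0 + c • b 1) φ = T (b 0) φ + T (b 1) (c • φ) := by
      ext u
      simp [T, smul_smul, mul_comm]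
    have h2 := congrArg F h1
    rw [map_add, hp, hp, hp] at h2
    have h3 := congrArg (b.coord 0) h2
    have h4 := congrArg (b.coord 1) h2
    simp at h3 h4
    rw [← h4, h3, mul_comm]
  have hp01 : ∀ φ, p (b 1) φ = p (b 0) φ := fun φ => by simpa using hcomp 1 φ
  let P : vanishingOn N K →ₗ[K] K :=
    { toFun := p (b 0)
      map_add' := by
        intro φ ψ
        have h2 := congrArg F (hTadd (b 0) φ ψ)
        rw [map_add, hp, hp, hp] at h2
        simpa using congrArg (b.coord 0) h2
      map_smul' := by
        intro c φ
        rw [← hp01, hcomp]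
        rfl }
  obtain ⟨P', hP'⟩ := LinearMap.exists_extend P
  obtain ⟨x, rfl⟩ := (evalEquiv K U).surjective P'
  have hx : ∀ φ : vanishingOn N K, p (b 0) φ = φ.1 x := fun φ => (LinearMap.congr_fun hP' φ).symm
  refine ⟨x, fun s => ?_⟩
  have hc : ∀ i, b.coord i ∘ₗ (s : U →ₗ[K] Y) ∈ vanishingOn N K := fun i u hu => by
    simp [s.2 u hu]
  have hs : s = T (b 0) ⟨_, hc 0⟩ + T (b 1) ⟨_, hc 1⟩ := by
    ext u
    have := b.sum_repr (s.1 u)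
    rw [Fin.sum_univ_two] at this
    simpa [T] using this.symm
  have hsx := b.sum_repr (s.1 x)
  rw [Fin.sum_univ_two] at hsx
  conv_lhs => rw [hs]
  rw [map_add, hp, hp, hp01, hx, hx]
  exact hsx

/-- Induction on `dim Y`, comparing `F` modulo two independent vectors outside the exceptional
subspace. -/
theorem IsRangeCompatible.isLocalMap_vanishingOn [FiniteDimensional K U] {N : Submodule K U} :
    ∀ (n : ℕ) {Y : Type*} [AddCommGroup Y] [Module K Y], finrank K Y = n + 2 →
      ∀ {S : Submodule K (U →ₗ[K] Y)}, S ≤ vanishingOn N Y →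
      finrank K (vanishingOn N Y) + 2 ≤ finrank K S + finrank K Y →
      ∀ {F : S →+ Y}, IsRangeCompatible S F → IsLocalMap S F := by
  intro n
  induction n with
  | zero =>
    intro Y _ _ hY S hSL hdim F hF
    have : FiniteDimensional K Y := FiniteDimensional.of_finrank_pos (by omega)
    exact hF.isLocalMap_vanishingOn_of_finrank_eq_two (by omega)
      (Submodule.eq_of_le_of_finrank_le hSL (by omega))
  | succ n ih =>
    intro Y _ _ hY S hSL hdim F hF
    have : FiniteDimensional K Y := FiniteDimensional.of_finrank_pos (by omega)
    -- Dividing by `y` lowers the allowed codimension by one. This is harmless if the bound is not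
    -- sharp; otherwise some `φ ⊗ y` must be missing from `S`, so that its codimension drops too.
    obtain ⟨B, hBtop, hB⟩ : ∃ B : Submodule K Y, B ≠ ⊤ ∧ ∀ y ∉ B,
        finrank K (vanishingOn N Y) + 3 ≤ finrank K S + finrank K Y ∨ y ∉ tensorFiber N S := by
      by_cases h : finrank K (vanishingOn N Y) + 3 ≤ finrank K S + finrank K Y
      · refine ⟨⊥, ?_, fun _ _ => Or.inl h⟩
        intro hbot
        have h0 := finrank_bot K Y
        rw [hbot, finrank_top] at h0
        omega
      · refine ⟨tensorFiber N S, fun ht => h ?_, fun y hy => Or.inr hy⟩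
        have := Submodule.finrank_mono (vanishingOn_le_of_tensorFiber_eq_top ht)
        omega
    have hmod : ∀ y ∉ B, ∃ x : U, ∀ s : S, F s - (s : U →ₗ[K] Y) x ∈ K ∙ y := by
      intro y hyB
      have hy : y ≠ 0 := fun h => hyB (h ▸ B.zero_mem)
      obtain ⟨F', hF', hFF'⟩ := hF.exists_map (K ∙ y).mkQ
      have hfr : finrank K (Y ⧸ K ∙ y) = n + 2 := by
        have := Submodule.finrank_quotient_add_finrank (K ∙ y)
        rw [finrank_span_singleton hy] at this
        omega
      have hle : S.map (LinearMap.compRight K (M := U) (K ∙ y).mkQ) ≤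
          vanishingOn N (Y ⧸ K ∙ y) := by
        rintro _ ⟨s, hs, rfl⟩ u hu
        simp [hSL hs u hu]
      have hge : vanishingOn N (Y ⧸ K ∙ y) ≤
          (vanishingOn N Y).map (LinearMap.compRight K (M := U) (K ∙ y).mkQ) := by
        intro f hf
        obtain ⟨g, hg⟩ := LinearMap.exists_rightInverse_of_surjective (K ∙ y).mkQ
          (Submodule.range_mkQ _)
        refine ⟨g ∘ₗ f, fun u hu => by simp [hf u hu], ?_⟩
        ext u
        exact LinearMap.congr_fun hg (f u)
      have hge' := Submodule.finrank_mono hge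
      obtain ⟨x, hx⟩ := ih hfr hle (by
        rcases hB y hyB with h | h
        · have := finrank_map_add_le (LinearMap.compRight K (M := U) (K ∙ y).mkQ) hSL
          omega
        · have := finrank_map_add_lt (LinearMap.compRight K (M := U) (K ∙ y).mkQ) hSL (by
            intro hle'
            refine h fun φ hφ => hle' ⟨fun u hu => by simp [hφ u hu], ?_⟩
            ext u
            simp)
          omega) hF'
      refine ⟨x, fun s => ?_⟩
      rw [← Submodule.ker_mkQ (K ∙ y), LinearMap.mem_ker, map_sub, sub_eq_zero, ← hFF', hx]
      rfl
    obtain ⟨y, hy, -⟩ := exists_notMem_notMem hBtop hBtop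
    obtain ⟨z, hz, hzy⟩ := exists_notMem_notMem hBtop (B := K ∙ y) (by
      simpa using span_singleton_sup_ne_top_of_finrank (A := (⊥ : Submodule K Y)) (y := y)
        (by rw [finrank_bot]; omega))
    have hy0 : y ≠ 0 := fun h => hy (h ▸ B.zero_mem)
    obtain ⟨x, hx⟩ := hmod y hy
    obtain ⟨x', hx'⟩ := hmod z hz
    obtain ⟨G, hG, hGF⟩ := hF.exists_sub x
    have h1 : ∀ s, G s ∈ K ∙ y := fun s => hGF s ▸ hx s
    have h2 : ∀ s : S, G s - (s : U →ₗ[K] Y) (x' - x) ∈ K ∙ z := by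
      intro s
      rw [hGF, map_sub]
      convert hx' s using 1
      abel
    by_cases hN : x' - x ∈ N
    · refine ⟨x, fun s => ?_⟩
      obtain ⟨a, ha⟩ := Submodule.mem_span_singleton.1 (h1 s)
      obtain ⟨c, hc⟩ := Submodule.mem_span_singleton.1 (h2 s)
      rw [hSL s.2 _ hN, sub_zero] at hc
      have := smul_add_smul_eq_zero_of_notMem_span hy0 hzy (a := a) (b := -c) (by
        rw [neg_smul, ha, hc, add_neg_cancel])
      rw [← sub_eq_zero, ← hGF, ← ha, this.1, zero_smul]
    · obtain ⟨φ, hφ, hφN⟩ := Submodule.exists_le_ker_of_notMem hN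
      refine (hG.false_of_two_lines hSL hdim (φ := (φ (x' - x))⁻¹ • φ) (inv_mul_cancel₀ hφ) ?_ hy0 hzy
        h1 h2).elim
      intro w u hu
      have : φ u = 0 := hφN hu
      simp [this]

end RangeCompatible

/-! ### Alternating maps along an injection, wedge products and quotients -/

section Alternating

variable {K U V Y : Type*} [Field K] [AddCommGroup U] [Module K U] [AddCommGroup V] [Module K V]
  [AddCommGroup Y] [Module K Y]

/-- The linear maps `f : U → Y` with `f (j v) v = 0` for all `v`, where `Y` is identified with the
dual space of `V`. -/
def alternatingAlong (e : Y ≃ₗ[K] Dual K V) (j : V →ₗ[K] U) : Submodule K (U →ₗ[K] Y) where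
  carrier := {f | ∀ v : V, e (f (j v)) v = 0}
  zero_mem' := by intro x; simp
  add_mem' := by
    intro f g hf hg x
    simp [hf x, hg x]
  smul_mem' := by
    intro c f hf x
    simp [hf x]

theorem alternatingAlong_id_swap {e : Y ≃ₗ[K] Dual K V} {f : V →ₗ[K] Y}
    (hf : f ∈ alternatingAlong e LinearMap.id) (v w : V) : e (f v) w = -e (f w) v := by
  have h := hf (v + w)
  have h1 := hf v
  have h2 := hf w
  simp only [LinearMap.id_apply, map_add, LinearMap.add_apply] at h h1 h2
  simp only [h1, h2, zero_add, add_zero] at h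
  exact eq_neg_of_add_eq_zero_right h

theorem ext_pairing (e : Y ≃ₗ[K] Dual K V) {y z : Y} (h : ∀ v, e y v = e z v) : y = z :=
  e.injective (LinearMap.ext h)

/-- The alternating form `y ∧ z`. -/
def wedgeForm (e : Y ≃ₗ[K] Dual K V) (y z : Y) : V →ₗ[K] Y :=
  (e y).smulRight z - (e z).smulRight y

theorem wedgeForm_apply (e : Y ≃ₗ[K] Dual K V) (y z : Y) (v : V) :
    wedgeForm e y z v = e y v • z - e z v • y := rfl

theorem wedgeForm_mem (e : Y ≃ₗ[K] Dual K V) (y z : Y) :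
    wedgeForm e y z ∈ alternatingAlong e LinearMap.id := by
  intro v
  simp only [LinearMap.id_apply, wedgeForm_apply, map_sub, map_smul, LinearMap.sub_apply,
    LinearMap.smul_apply, smul_eq_mul]
  ring

theorem wedgeForm_add_right (e : Y ≃ₗ[K] Dual K V) (x y z : Y) :
    wedgeForm e x (y + z) = wedgeForm e x y + wedgeForm e x z := by
  ext v
  simp only [wedgeForm_apply, LinearMap.add_apply, map_add]
  module

theorem wedgeForm_smul_right (e : Y ≃ₗ[K] Dual K V) (c : K) (y z : Y) :
    wedgeForm e y (c • z) = c • wedgeForm e y z := by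
  ext v
  simp only [wedgeForm_apply, LinearMap.smul_apply, map_smul, smul_eq_mul]
  module

theorem wedgeForm_swap (e : Y ≃ₗ[K] Dual K V) (y z : Y) :
    wedgeForm e y z = -wedgeForm e z y := by
  rw [wedgeForm, wedgeForm, neg_sub]

theorem wedgeForm_self (e : Y ≃ₗ[K] Dual K V) (y : Y) : wedgeForm e y y = 0 := by
  rw [wedgeForm, sub_self]

/-- The vectors `y` such that `A` contains all `z ∧ y`. -/
def wedgeFiber (e : Y ≃ₗ[K] Dual K V) (A : Submodule K (V →ₗ[K] Y)) : Submodule K Y where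
  carrier := {y | ∀ z, wedgeForm e z y ∈ A}
  zero_mem' := by
    intro z
    have : wedgeForm e z 0 = 0 := by simp [wedgeForm]
    rw [this]
    exact A.zero_mem
  add_mem' := by
    intro y z hy hz x
    rw [wedgeForm_add_right]
    exact A.add_mem (hy x) (hz x)
  smul_mem' := by
    intro c y hy x
    rw [wedgeForm_smul_right]
    exact A.smul_mem c (hy x)

theorem alternatingAlong_id_le_of_wedgeFiber_eq_top [FiniteDimensional K V]
    {e : Y ≃ₗ[K] Dual K V} {A : Submodule K (V →ₗ[K] Y)} (h : wedgeFiber e A = ⊤) :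
    alternatingAlong e LinearMap.id ≤ A := by
  intro f hf
  let b := finBasis K V
  have : f = ∑ i, ∑ j, if i < j then
      e (f (b i)) (b j) • wedgeForm e (e.symm (b.coord i)) (e.symm (b.coord j)) else 0 := by
    refine b.ext fun k => e.injective <| b.ext fun l => ?_
    have key : ∀ i j, e ((if i < j then
        e (f (b i)) (b j) • wedgeForm e (e.symm (b.coord i)) (e.symm (b.coord j))
        else 0) (b k)) (b l) =
        (if i = k then if j = l then if k < l then e (f (b k)) (b l) else 0 else 0 else 0) -
        (if i = l then if j = k then if l < k then e (f (b l)) (b k) else 0 else 0 else 0) := by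
      intro i j
      by_cases hij : i < j
      · simp only [if_pos hij, LinearMap.smul_apply, wedgeForm_apply, map_sub, map_smul,
          LinearEquiv.apply_symm_apply, LinearMap.sub_apply, Basis.coord_apply,
          Basis.repr_self, Finsupp.single_apply, smul_eq_mul]
        grind
      · simp only [if_neg hij, LinearMap.zero_apply, map_zero]
        grind
    simp only [LinearMap.sum_apply, map_sum, key, Finset.sum_sub_distrib, Finset.sum_ite_eq',
      Finset.mem_univ, if_true, Finset.sum_const_zero, Finset.sum_ite_irrel]
    rcases lt_trichotomy k l with hkl | hkl | hkl
    · simp [hkl, hkl.not_gt]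
    · subst hkl
      simpa using hf (b k)
    · simpa [hkl, hkl.not_gt] using alternatingAlong_id_swap hf (b k) (b l)
  rw [this]
  refine A.sum_mem fun i _ => A.sum_mem fun j _ => ?_
  split_ifs
  · have : e.symm (b.coord j) ∈ wedgeFiber e A := h ▸ Submodule.mem_top
    exact A.smul_mem _ (this _)
  · exact A.zero_mem

/-- Because `y ∧ y = 0`, the products of `y` with the fiber give all products with `y`, so `y` is in
the fiber as well. -/
theorem alternatingAlong_id_le_of_wedgeFiber_sup_eq_top [FiniteDimensional K V]
    {e : Y ≃ₗ[K] Dual K V} {A : Submodule K (V →ₗ[K] Y)} {y : Y}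
    (h : wedgeFiber e A ⊔ K ∙ y = ⊤) : alternatingAlong e LinearMap.id ≤ A := by
  have hdec : ∀ x, ∃ z ∈ wedgeFiber e A, ∃ c : K, x = z + c • y := by
    intro x
    obtain ⟨z, hz, w, hw, rfl⟩ := Submodule.mem_sup.1 (h ▸ Submodule.mem_top : x ∈ _)
    obtain ⟨c, rfl⟩ := Submodule.mem_span_singleton.1 hw
    exact ⟨z, hz, c, rfl⟩
  have hy : y ∈ wedgeFiber e A := by
    intro x
    obtain ⟨z, hz, c, rfl⟩ := hdec x
    rw [wedgeForm_swap, wedgeForm_add_right, wedgeForm_smul_right, wedgeForm_self, smul_zero,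
      add_zero]
    exact A.neg_mem (hz y)
  refine alternatingAlong_id_le_of_wedgeFiber_eq_top (eq_top_iff.2 fun x _ => ?_)
  obtain ⟨z, hz, c, rfl⟩ := hdec x
  exact Submodule.add_mem _ hz (Submodule.smul_mem _ c hy)

theorem map_alternatingAlong_le {e : Y ≃ₗ[K] Dual K V} {j : V →ₗ[K] U}
    {S : Submodule K (U →ₗ[K] Y)} (hS : S ≤ alternatingAlong e j) :
    S.map (LinearMap.lcomp K Y j) ≤ alternatingAlong e LinearMap.id := by
  rintro _ ⟨f, hf, rfl⟩ x
  exact hS hf x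

theorem vanishingOn_range_eq (e : Y ≃ₗ[K] Dual K V) (j : V →ₗ[K] U) :
    vanishingOn (LinearMap.range j) Y =
      alternatingAlong e j ⊓ LinearMap.ker (LinearMap.lcomp K Y j) := by
  ext f
  constructor
  · intro hf
    have h : ∀ v, f (j v) = 0 := fun v => hf _ ⟨v, rfl⟩
    exact ⟨fun v => by simp [h v], LinearMap.ext h⟩
  · rintro ⟨-, hf⟩ _ ⟨v, rfl⟩
    exact LinearMap.congr_fun hf v

theorem exists_quotient_pairing (e : Y ≃ₗ[K] Dual K V) (y : Y) :
    ∃ e' : (Y ⧸ K ∙ y) ≃ₗ[K] Dual K (LinearMap.ker (e y)),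
      ∀ z v, e' ((K ∙ y).mkQ z) v = e z v := by
  let r : Y →ₗ[K] Dual K (LinearMap.ker (e y)) :=
    LinearMap.lcomp K K (LinearMap.ker (e y)).subtype ∘ₗ e.toLinearMap
  have hr : ∀ z, r z = 0 → z ∈ K ∙ y := by
    intro z hz
    have h := mem_span_singleton_of_ker_le (y := e y) (φ := e z) fun v hv =>
      LinearMap.congr_fun hz ⟨v, hv⟩
    obtain ⟨c, hc⟩ := Submodule.mem_span_singleton.1 h
    exact Submodule.mem_span_singleton.2 ⟨c, e.injective (by rw [map_smul, hc])⟩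
  have hle : K ∙ y ≤ LinearMap.ker r := by
    rw [Submodule.span_singleton_le_iff_mem]
    exact LinearMap.ext fun v => v.2
  refine ⟨LinearEquiv.ofBijective ((K ∙ y).liftQ r hle) ⟨?_, ?_⟩, fun z v => rfl⟩
  · rw [injective_iff_map_eq_zero]
    intro a ha
    obtain ⟨z, rfl⟩ := (K ∙ y).mkQ_surjective a
    exact (Submodule.Quotient.mk_eq_zero _).2 (hr z ha)
  · intro φ
    obtain ⟨ψ, rfl⟩ := LinearMap.exists_extend φ
    refine ⟨(K ∙ y).mkQ (e.symm ψ), LinearMap.ext fun v => ?_⟩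
    change e (e.symm ψ) v = ψ v
    rw [e.apply_symm_apply]

theorem exists_ker_projection {y : Dual K V} (hy : y ≠ 0) :
    ∃ (a : V) (p : V →ₗ[K] LinearMap.ker y), ∀ v, (p v : V) = v - y v • a := by
  obtain ⟨a, ha⟩ : ∃ a, y a ≠ 0 := by
    by_contra! h'
    exact hy (LinearMap.ext h')
  refine ⟨(y a)⁻¹ • a, LinearMap.codRestrict _ (LinearMap.id - y.smulRight ((y a)⁻¹ • a)) ?_,
    fun v => rfl⟩
  intro v
  simp [ha]

/-- Composing with a projection `p` of `V` onto `ker (e y)` lifts `f` to `h : U → Y`, whose defect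
`h(j v)[v]` equals `y(v) f(j a)[p v]`. The term `g ⊗ y` cancels it and vanishes modulo `y`. -/
theorem alternatingAlong_quotient_le_map {e : Y ≃ₗ[K] Dual K V} {j : V →ₗ[K] U}
    (hj : Function.Injective j) {y : Y} (hy : y ≠ 0)
    {e' : (Y ⧸ K ∙ y) ≃ₗ[K] Dual K (LinearMap.ker (e y))}
    (he' : ∀ z v, e' ((K ∙ y).mkQ z) v = e z v) :
    alternatingAlong e' (j ∘ₗ (LinearMap.ker (e y)).subtype) ≤
      (alternatingAlong e j).map (LinearMap.compRight K (M := U) (K ∙ y).mkQ) := by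
  intro f hf
  obtain ⟨a, p, hp⟩ := exists_ker_projection (y := e y) (by simpa using hy)
  obtain ⟨q, hq⟩ := LinearMap.exists_leftInverse_of_injective j (LinearMap.ker_eq_bot.2 hj)
  have hq' : ∀ v, q (j v) = v := LinearMap.congr_fun hq
  let g : Dual K U := -(e' (f (j a)) ∘ₗ p ∘ₗ q)
  let h : U →ₗ[K] Y := e.symm.toLinearMap ∘ₗ LinearMap.lcomp K K p ∘ₗ e'.toLinearMap ∘ₗ f
  have hh : ∀ u v, e (h u) v = e' (f u) (p v) := by
    intro u v
    change e (e.symm _) v = _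
    rw [e.apply_symm_apply]
    rfl
  refine ⟨h + g.smulRight y, fun v => ?_, ?_⟩
  · have h1 : e' (f (j (p v))) (p v) = 0 := hf (p v)
    rw [hp v] at h1
    simp only [map_sub, map_smul, LinearMap.sub_apply, LinearMap.smul_apply, smul_eq_mul] at h1
    simp only [LinearMap.add_apply, map_add, hh, LinearMap.comp_apply,
      LinearMap.smulRight_apply, LinearMap.smul_apply, LinearMap.neg_apply, g, smul_eq_mul,
      map_smul, hq']
    rw [← h1]
    ring
  · ext u
    refine ext_pairing e' fun v => ?_
    have hv : e y v = 0 := v.2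
    have hpv : p v = v := Subtype.ext (by rw [hp, hv, zero_smul, sub_zero])
    change e' ((K ∙ y).mkQ (h u + g u • y)) v = _
    rw [he']
    simp [hh, hv, hpv]

theorem alternatingAlong_id_quotient_le_map {e : Y ≃ₗ[K] Dual K V} {y : Y} (hy : y ≠ 0)
    {e' : (Y ⧸ K ∙ y) ≃ₗ[K] Dual K (LinearMap.ker (e y))}
    (he' : ∀ z v, e' ((K ∙ y).mkQ z) v = e z v) :
    alternatingAlong e' LinearMap.id ≤
      (alternatingAlong e LinearMap.id).map (LinearMap.compRight K (K ∙ y).mkQ ∘ₗ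
        LinearMap.lcomp K Y (LinearMap.ker (e y)).subtype) := by
  intro f hf
  obtain ⟨a, p, hp⟩ := exists_ker_projection (y := e y) (by simpa using hy)
  have hpv : ∀ v : LinearMap.ker (e y), p v = v := fun v => Subtype.ext (by
    have hv : e y v = 0 := v.2
    rw [hp, hv, zero_smul, sub_zero])
  let h : V →ₗ[K] Y :=
    e.symm.toLinearMap ∘ₗ LinearMap.lcomp K K p ∘ₗ e'.toLinearMap ∘ₗ f ∘ₗ p
  have hh : ∀ u v, e (h u) v = e' (f (p u)) (p v) := by
    intro u v
    change e (e.symm _) v = _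
    rw [e.apply_symm_apply]
    rfl
  refine ⟨h, fun v => ?_, ?_⟩
  · rw [hh]
    exact hf (p v)
  · ext u
    refine ext_pairing e' fun v => ?_
    change e' ((K ∙ y).mkQ (h u)) v = _
    rw [he', hh, hpv, hpv]

end Alternating

/-! ### The case `dim V = 3` -/

section ThreeDimensional

variable {K U V Y : Type*} [Field K] [AddCommGroup U] [Module K U] [AddCommGroup V] [Module K V]
  [AddCommGroup Y] [Module K Y]

/-- On a three-dimensional space, the alternating forms are parametrized by the vectors through
the triple product. -/
theorem exists_tripleProduct (hV : finrank K V = 3) (e : Y ≃ₗ[K] Dual K V) :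
    ∃ D : V →ₗ[K] V →ₗ[K] Y, (∀ a, D a ∈ alternatingAlong e LinearMap.id) ∧
      (∀ f ∈ alternatingAlong e LinearMap.id, ∃ a, D a = f) ∧ (∀ a v, D a v = -D v a) := by
  have : FiniteDimensional K V := FiniteDimensional.of_finrank_pos (by omega)
  let b := finBasisOfFinrankEq K V hV
  let c : Fin 3 → Y := fun i => e.symm (b.coord i)
  let D : V →ₗ[K] V →ₗ[K] Y := (b.coord 0).smulRight (wedgeForm e (c 1) (c 2)) +
    (b.coord 1).smulRight (wedgeForm e (c 2) (c 0)) +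
    (b.coord 2).smulRight (wedgeForm e (c 0) (c 1))
  have hD : ∀ a v w, e (D a v) w =
      b.repr a 0 * (b.repr v 1 * b.repr w 2 - b.repr v 2 * b.repr w 1) +
      b.repr a 1 * (b.repr v 2 * b.repr w 0 - b.repr v 0 * b.repr w 2) +
      b.repr a 2 * (b.repr v 0 * b.repr w 1 - b.repr v 1 * b.repr w 0) := by
    intro a v w
    simp only [D, c, LinearMap.add_apply, LinearMap.smulRight_apply, LinearMap.smul_apply,
      wedgeForm_apply, map_add, map_smul, map_sub, LinearEquiv.apply_symm_apply,
      LinearMap.sub_apply, Basis.coord_apply, smul_eq_mul]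
  refine ⟨D, fun a v => ?_, fun f hf => ?_, fun a v => ext_pairing e fun w => ?_⟩
  · rw [LinearMap.id_apply, hD]
    ring
  · refine ⟨e (f (b 1)) (b 2) • b 0 + e (f (b 2)) (b 0) • b 1 + e (f (b 0)) (b 1) • b 2,
      b.ext fun k => e.injective <| b.ext fun l => ?_⟩
    rw [hD]
    have h0 : ∀ i, e (f (b i)) (b i) = 0 := fun i => hf (b i)
    have h10 := alternatingAlong_id_swap hf (b 1) (b 0)
    have h21 := alternatingAlong_id_swap hf (b 2) (b 1)
    have h02 := alternatingAlong_id_swap hf (b 0) (b 2)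
    fin_cases k <;> fin_cases l <;> simp [h0, h10, h21, h02]
  · simp only [map_neg, LinearMap.neg_apply, hD]
    ring

/-- The hypothesis allows the implication from `f v = 0` to `G(f)[v] = 0` to fail along at most one
line. Transported by the triple product, `G` becomes an additive map `P` with `P(a)[a] = 0` off that
line. -/
theorem exists_eq_apply_of_finrank_eq_three (hV : finrank K V = 3) (e : Y ≃ₗ[K] Dual K V)
    (G : alternatingAlong e (LinearMap.id (M := V)) →+ Y)
    (hG : ∀ v w : V, v ≠ 0 → w ∉ K ∙ v →
      (∀ f : alternatingAlong e (LinearMap.id (M := V)), f.1 v = 0 → e (G f) v = 0) ∨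
      ∀ f : alternatingAlong e (LinearMap.id (M := V)), f.1 w = 0 → e (G f) w = 0) :
    ∃ x : V, ∀ f, G f = f.1 x := by
  obtain ⟨D, hDmem, hDsurj, hDswap⟩ := exists_tripleProduct hV e
  have hDself : ∀ a, D a a = 0 := fun a => ext_pairing e fun w => by
    rw [alternatingAlong_id_swap (hDmem a), hDswap, map_neg, LinearMap.neg_apply, neg_neg]
    simpa [hDswap w a] using hDmem w a
  let P : V →+ Y := G.comp (D.codRestrict _ hDmem).toAddMonoidHom
  have hPG : ∀ a, P a = G ⟨D a, hDmem a⟩ := fun a => rfl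
  have hP : ∀ a, e (P a) a = 0 := by
    intro a
    by_contra ha
    have ha0 : a ≠ 0 := by
      rintro rfl
      simp at ha
    have hgood : ∀ w ∉ K ∙ a, e (P w) w = 0 := fun w hw =>
      (hG a w ha0 hw).resolve_left (fun h => ha (h _ (hDself a))) _ (hDself w)
    -- The bracket is additive in `w`; taking `w = b`, `c` and `b + c`, all outside `K a`, forces
    -- `P(a)[a] = 0` over any field.
    have hsum : ∀ w ∉ K ∙ a, e (P a) a + (e (P a) w + e (P w) a) = 0 := by
      intro w hw
      have h1 := hgood w hw
      have h2 := hgood (a + w) fun h =>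
        hw ((Submodule.add_mem_iff_right _ (Submodule.mem_span_singleton_self a)).1 h)
      simp only [map_add, LinearMap.add_apply, h1] at h2
      linear_combination h2
    have hfin : finrank K (K ∙ a) = 1 := finrank_span_singleton ha0
    obtain ⟨b, hb⟩ : ∃ b, b ∉ K ∙ a := by
      by_contra! h
      have ht : K ∙ a = ⊤ := eq_top_iff.2 fun x _ => h x
      rw [ht, finrank_top] at hfin
      omega
    obtain ⟨c, hc⟩ : ∃ c, c ∉ K ∙ a ⊔ K ∙ b := by
      by_contra! h
      exact span_singleton_sup_ne_top_of_finrank (A := K ∙ a) (y := b) (by omega)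
        (eq_top_iff.2 fun x _ => h x)
    have hca : c ∉ K ∙ a := fun h => hc (Submodule.mem_sup_left h)
    have hbc : b + c ∉ K ∙ a := by
      intro h
      refine hc ?_
      rw [← add_sub_cancel_left b c]
      exact Submodule.sub_mem _ (Submodule.mem_sup_left h)
        (Submodule.mem_sup_right (Submodule.mem_span_singleton_self b))
    have h1 := hsum b hb
    have h2 := hsum c hca
    have h3 := hsum _ hbc
    simp only [map_add, LinearMap.add_apply] at h3
    exact ha (by linear_combination h1 + h2 - h3)
  have hPswap : ∀ a b, e (P a) b = -e (P b) a := by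
    intro a b
    have h := hP (a + b)
    simp only [map_add, LinearMap.add_apply, hP] at h
    linear_combination h
  let P' : V →ₗ[K] Y :=
    { toFun := P
      map_add' := P.map_add
      -- Antisymmetry moves the scalar to the argument of `P w`, which is linear.
      map_smul' := fun c a => ext_pairing e fun w => by
        simp [hPswap _ w] }
  obtain ⟨x, hx⟩ := hDsurj P' hP
  refine ⟨-x, ?_⟩
  rintro ⟨f, hf⟩
  obtain ⟨a, rfl⟩ := hDsurj f hf
  calc G ⟨D a, hf⟩ = P' a := rfl
    _ = D a (-x) := by rw [← hx, hDswap, map_neg]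

theorem IsRangeCompatible.isLocalMap_alternatingAlong_of_finrank_eq_three [FiniteDimensional K U]
    (hV : finrank K V = 3) (e : Y ≃ₗ[K] Dual K V) {j : V →ₗ[K] U} (hj : Function.Injective j)
    {S : Submodule K (U →ₗ[K] Y)} (hSL : S ≤ alternatingAlong e j)
    (hdim : finrank K (alternatingAlong e j) ≤ finrank K S + 1)
    (hr : S.map (LinearMap.lcomp K Y j) = alternatingAlong e LinearMap.id)
    {F : S →+ Y} (hF : IsRangeCompatible S F) : IsLocalMap S F := by
  have : FiniteDimensional K V := FiniteDimensional.of_finrank_pos (by omega)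
  have : FiniteDimensional K Y := Module.Finite.equiv e.symm
  have hY : finrank K Y = 3 := by rw [e.finrank_eq, Subspace.dual_finrank_eq, hV]
  have hL₀ := vanishingOn_range_eq e j
  obtain ⟨L₀, hL₀'⟩ : ∃ L₀, L₀ = vanishingOn (LinearMap.range j) Y := ⟨_, rfl⟩
  obtain ⟨S₀, hS₀⟩ : ∃ S₀, S₀ = S ⊓ LinearMap.ker (LinearMap.lcomp K Y j) := ⟨_, rfl⟩
  rw [← hL₀'] at hL₀
  have hS₀S : S₀ ≤ S := hS₀ ▸ inf_le_left
  have hSL₀ : S₀ ≤ L₀ := by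
    rw [hL₀, hS₀]
    exact inf_le_inf_right _ hSL
  have hcod : finrank K L₀ ≤ finrank K S₀ + 1 := by
    have h1 := finrank_map_add_finrank_inf_ker (LinearMap.lcomp K Y j) S
    have h2 := finrank_map_add_finrank_inf_ker (LinearMap.lcomp K Y j) (alternatingAlong e j)
    have h4 := Submodule.finrank_mono (Submodule.map_mono (f := LinearMap.lcomp K Y j) hSL)
    rw [← hL₀] at h2
    rw [← hS₀] at h1
    omega
  -- As `dim Y = 3`, the allowed codimension `dim Y - 2` is exactly the 1 available for `S₀` in
  -- `L₀`.
  obtain ⟨x₀, hx₀⟩ : IsLocalMap S₀ (F.comp (Submodule.inclusion hS₀S).toAddMonoidHom) :=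
    IsRangeCompatible.isLocalMap_vanishingOn 1 hY (hL₀' ▸ hSL₀) (by rw [← hL₀']; omega)
      fun s => hF (Submodule.inclusion hS₀S s)
  obtain ⟨F₁, hF₁, hFF₁⟩ := hF.exists_sub x₀
  obtain ⟨G, hG⟩ := exists_addMonoidHom_map (LinearMap.lcomp K Y j) F₁ (by
    intro s hs
    rw [hFF₁, sub_eq_zero]
    exact hx₀ ⟨s, hS₀ ▸ ⟨s.2, hs⟩⟩)
  let G' : alternatingAlong e (LinearMap.id (M := V)) →+ Y :=
    G.comp (Submodule.inclusion hr.ge).toAddMonoidHom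
  have hG' : ∀ (s : S) (hs : s.1 ∘ₗ j ∈ alternatingAlong e LinearMap.id),
      G' ⟨s.1 ∘ₗ j, hs⟩ = F₁ s := fun s _ => hG s
  let M : V → Submodule K (U →ₗ[K] Y) := fun v =>
    L₀ ⊓ LinearMap.ker (LinearMap.compRight K (M := U) (LinearMap.applyₗ v ∘ₗ e.toLinearMap))
  have hM : ∀ v h, h ∈ M v ↔ h ∈ L₀ ∧ ∀ u, e (h u) v = 0 := fun v h =>
    and_congr_right fun _ => LinearMap.ext_iff
  -- Modulo `S₀`, a preimage of `f` can be chosen as `f ∘ q + h`, with all values of `h` vanishing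
  -- at `v`. By range-compatibility `G'(f)[v] = f(q u)[v] = -f(v)[q u]` for some `u`, which is zero
  -- when `f v = 0`.
  have hgood : ∀ v, L₀ ≤ S₀ ⊔ M v →
      ∀ f : alternatingAlong e (LinearMap.id (M := V)), f.1 v = 0 → e (G' f) v = 0 := by
    rintro v hv ⟨f, hf⟩ hfv
    obtain ⟨s₁, hs₁, rfl⟩ := hr.ge hf
    obtain ⟨q, hq⟩ := LinearMap.exists_leftInverse_of_injective j (LinearMap.ker_eq_bot.2 hj)
    have hq' : ∀ v, q (j v) = v := LinearMap.congr_fun hq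
    have hh : s₁ - s₁ ∘ₗ j ∘ₗ q ∈ L₀ := by
      rw [hL₀']
      rintro _ ⟨w, rfl⟩
      simp [hq']
    obtain ⟨s₀, hs₀, h, hhM, hsum⟩ := Submodule.mem_sup.1 (hv hh)
    have hs₀j : s₀ ∘ₗ j = 0 := by
      rw [hS₀] at hs₀
      exact hs₀.2
    have hsj : (s₁ - s₀) ∘ₗ j = s₁ ∘ₗ j := by
      rw [LinearMap.sub_comp, hs₀j, sub_zero]
    have hGs := hG' ⟨s₁ - s₀, S.sub_mem hs₁ (hS₀S hs₀)⟩ (by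
      rw [hsj]
      exact hf)
    obtain ⟨u, hu⟩ := hF₁ ⟨s₁ - s₀, S.sub_mem hs₁ (hS₀S hs₀)⟩
    have hval : (s₁ - s₀) u = s₁ (j (q u)) + h u := by
      have := LinearMap.congr_fun hsum u
      simp only [LinearMap.add_apply, LinearMap.sub_apply, LinearMap.comp_apply] at this ⊢
      rw [sub_eq_iff_eq_add, add_comm _ (s₀ u), ← add_assoc, add_right_comm, this]
      abel
    simp only [hsj] at hGs
    change e (G' ⟨s₁ ∘ₗ j, hf⟩) v = 0
    rw [hGs, ← hu]
    change e ((s₁ - s₀) u) v = 0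
    have h1 : e (s₁ (j (q u))) v = -e (s₁ (j v)) (q u) := alternatingAlong_id_swap hf (q u) v
    have h2 : s₁ (j v) = 0 := hfv
    rw [hval, map_add, LinearMap.add_apply, ((hM v h).1 hhM).2 u, h1, h2]
    simp
  have hsup : ∀ v, ¬ M v ≤ S₀ → L₀ ≤ S₀ ⊔ M v := by
    intro v hv
    have hlt : S₀ < S₀ ⊔ M v := by
      refine lt_of_le_of_ne le_sup_left fun h => hv ?_
      rw [h]
      exact le_sup_right
    have h1 := Submodule.finrank_lt_finrank_of_lt hlt
    exact (Submodule.eq_of_le_of_finrank_le (sup_le hSL₀ inf_le_left)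
      (show finrank K L₀ ≤ finrank K (S₀ ⊔ M v : Submodule K (U →ₗ[K] Y)) by omega)).ge
  obtain ⟨x, hx⟩ := exists_eq_apply_of_finrank_eq_three hV e G' (by
    intro v w hv hw
    by_cases h1 : M v ≤ S₀
    · by_cases h2 : M w ≤ S₀
      -- For independent `v` and `w`, `L₀ = M v + M w`: with `η` killing `v` but not `w`, `g` lies
      -- in `M v` and `h - g` in `M w`. So here `S₀ = L₀`.
      · refine Or.inl (hgood v (le_sup_of_le_left fun h hh => ?_))
        obtain ⟨η, hη, hηv⟩ := Submodule.exists_le_ker_of_notMem hw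
        have hηv' : η v = 0 := hηv (Submodule.mem_span_singleton_self v)
        let g : U →ₗ[K] Y :=
          (LinearMap.applyₗ w ∘ₗ e.toLinearMap ∘ₗ h).smulRight ((η w)⁻¹ • e.symm η)
        have hgu : ∀ u z, e (g u) z = e (h u) w * (η w)⁻¹ * η z := by
          intro u z
          simp [g, mul_assoc]
        have hgL : g ∈ L₀ := by
          rw [hL₀'] at hh ⊢
          intro u hu
          simp [g, hh u hu]
        rw [← sub_add_cancel h g]
        refine S₀.add_mem (h2 ((hM _ _).2 ⟨L₀.sub_mem hh hgL, fun u => ?_⟩))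
          (h1 ((hM _ _).2 ⟨hgL, fun u => ?_⟩))
        · rw [LinearMap.sub_apply, map_sub, LinearMap.sub_apply, hgu, mul_assoc,
            inv_mul_cancel₀ hη, mul_one, sub_self]
        · rw [hgu, hηv', mul_zero]
      · exact Or.inr (hgood w (hsup w h2))
    · exact Or.inl (hgood v (hsup v h1)))
  refine ⟨x₀ + j x, fun s => ?_⟩
  have h := hx ⟨s.1 ∘ₗ j, map_alternatingAlong_le hSL (Submodule.mem_map_of_mem s.2)⟩
  rw [hG', hFF₁, sub_eq_iff_eq_add'] at h
  rw [h, map_add]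
  rfl

end ThreeDimensional

/-! ### Induction on the dimension of `V` -/

section Induction

variable {K U : Type*} [Field K] [AddCommGroup U] [Module K U]

/-- Reduction modulo a vector `y` preserves the codimension assumptions, unless one of them is
sharp and `y` belongs to the corresponding exceptional subspace. -/
theorem finrank_add_le_of_map_quotient [FiniteDimensional K U] {V Y : Type*}
    [AddCommGroup V] [Module K V] [AddCommGroup Y] [Module K Y] [FiniteDimensional K V]
    [FiniteDimensional K Y] {e : Y ≃ₗ[K] Dual K V}
    {j : V →ₗ[K] U} (hj : Function.Injective j) {S : Submodule K (U →ₗ[K] Y)}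
    (hSL : S ≤ alternatingAlong e j) {d₁ d₂ : ℕ} {y : Y} (hy : y ≠ 0)
    (h₁ : finrank K (alternatingAlong e j) + 2 ≤ finrank K S + d₁ ∨
      finrank K (alternatingAlong e j) + 2 ≤ finrank K S + (d₁ + 1) ∧
        y ∉ tensorFiber (LinearMap.range j) S)
    (h₂ : finrank K (alternatingAlong e (LinearMap.id (M := V))) + 3 ≤
        finrank K (S.map (LinearMap.lcomp K Y j)) + d₂ ∨
      finrank K (alternatingAlong e (LinearMap.id (M := V))) + 3 ≤
        finrank K (S.map (LinearMap.lcomp K Y j)) + (d₂ + 1) ∧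
        y ∉ wedgeFiber e (S.map (LinearMap.lcomp K Y j)))
    {e' : (Y ⧸ K ∙ y) ≃ₗ[K] Dual K (LinearMap.ker (e y))}
    (he' : ∀ z v, e' ((K ∙ y).mkQ z) v = e z v)
    {S' : Submodule K (U →ₗ[K] (Y ⧸ K ∙ y))}
    (hS' : S' = S.map (LinearMap.compRight K (M := U) (K ∙ y).mkQ))
    {j' : LinearMap.ker (e y) →ₗ[K] U} (hj' : j' = j ∘ₗ (LinearMap.ker (e y)).subtype) :
    S' ≤ alternatingAlong e' j' ∧
    finrank K (alternatingAlong e' j') + 2 ≤ finrank K S' + d₁ ∧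
    finrank K (alternatingAlong e' (LinearMap.id (M := LinearMap.ker (e y)))) + 3 ≤
        finrank K (S'.map (LinearMap.lcomp K (Y ⧸ K ∙ y) j')) + d₂ := by
  subst hS' hj'
  refine ⟨?_, ?_, ?_⟩
  · rintro _ ⟨s, hs, rfl⟩ v
    exact (he' _ v).trans (hSL hs v)
  · have hge := Submodule.finrank_mono (alternatingAlong_quotient_le_map hj hy he')
    rcases h₁ with h | ⟨h, hmem⟩
    · have := finrank_map_add_le (LinearMap.compRight K (M := U) (K ∙ y).mkQ) hSL
      omega
    · have := finrank_map_add_lt (LinearMap.compRight K (M := U) (K ∙ y).mkQ) hSL (by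
        intro hle
        refine hmem fun φ hφ => hle ⟨fun v => by simp [hφ (j v) ⟨v, rfl⟩], ?_⟩
        ext u
        simp)
      omega
  · have hge := Submodule.finrank_mono (alternatingAlong_id_quotient_le_map hy he')
    have hmap : (S.map (LinearMap.compRight K (M := U) (K ∙ y).mkQ)).map
        (LinearMap.lcomp K (Y ⧸ K ∙ y) (j ∘ₗ (LinearMap.ker (e y)).subtype)) =
        (S.map (LinearMap.lcomp K Y j)).map (LinearMap.compRight K (K ∙ y).mkQ ∘ₗ
          LinearMap.lcomp K Y (LinearMap.ker (e y)).subtype) := by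
      rw [← Submodule.map_comp, ← Submodule.map_comp]
      rfl
    rw [hmap]
    rcases h₂ with h | ⟨h, hmem⟩
    · have := finrank_map_add_le (LinearMap.compRight K (K ∙ y).mkQ ∘ₗ
        LinearMap.lcomp K Y (LinearMap.ker (e y)).subtype) (map_alternatingAlong_le hSL)
      omega
    · have := finrank_map_add_lt (LinearMap.compRight K (K ∙ y).mkQ ∘ₗ
        LinearMap.lcomp K Y (LinearMap.ker (e y)).subtype) (map_alternatingAlong_le hSL) (by
          intro hle
          refine hmem fun z => hle ⟨wedgeForm_mem e z y, ?_⟩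
          ext v
          have hv : e y v = 0 := v.2
          simp [wedgeForm_apply, hv])
      omega

/-- All alternating forms together reach every functional vanishing at `v`, a space of dimension
`dim V - 1`. Confinement to `span {y, z}` thus costs codimension at least `dim V - 3`. Equality
follows, so the span vanishes at `v` and `A` contains every form sending `v` into it, such as `w ∧
y`. -/
theorem mem_wedgeFiber_of_forall_apply_mem_span {V Y : Type*}
    [AddCommGroup V] [Module K V] [AddCommGroup Y] [Module K Y] [FiniteDimensional K V]
    [FiniteDimensional K Y] {e : Y ≃ₗ[K] Dual K V} {A : Submodule K (V →ₗ[K] Y)}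
    (hA : A ≤ alternatingAlong e LinearMap.id)
    (hdim : finrank K (alternatingAlong e (LinearMap.id (M := V))) + 3 ≤
      finrank K A + finrank K V)
    {v : V} (hv : v ≠ 0) {y z : Y} (hAv : ∀ f ∈ A, f v ∈ Submodule.span K {y, z}) :
    finrank K A + finrank K V ≤ finrank K (alternatingAlong e (LinearMap.id (M := V))) + 3 ∧
      y ∈ wedgeFiber e A := by
  classical
  let R : (V →ₗ[K] Y) →ₗ[K] Y := LinearMap.applyₗ v
  let ν : Dual K Y := LinearMap.applyₗ v ∘ₗ e.toLinearMap
  have hν : ∀ w, ν w = e w v := fun w => rfl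
  obtain ⟨φ₀, hφ₀, -⟩ := Submodule.exists_le_ker_of_notMem (p := (⊥ : Submodule K V)) (v := v) (by simpa using hv)
  obtain ⟨φ, hφ⟩ : ∃ φ : Dual K V, φ v = 1 := ⟨(φ₀ v)⁻¹ • φ₀, inv_mul_cancel₀ hφ₀⟩
  have hν0 : ν ≠ 0 := by
    intro h
    have := LinearMap.congr_fun h (e.symm φ)
    simp [hν, hφ] at this
  have hY : finrank K Y = finrank K V := by rw [e.finrank_eq, Subspace.dual_finrank_eq]
  have hker := Module.Dual.finrank_ker_add_one_of_ne_zero hν0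
  have hL : LinearMap.ker ν ≤ (alternatingAlong e LinearMap.id).map R := by
    intro w hw
    have hw' : e w v = 0 := hw
    refine ⟨wedgeForm e (e.symm φ) w, wedgeForm_mem _ _ _, ?_⟩
    simp [R, wedgeForm_apply, hφ, hw']
  have hL' := Submodule.finrank_mono hL
  have hP : finrank K (Submodule.span K ({y, z} : Set Y)) ≤ 2 := by
    have := finrank_span_finset_le_card (R := K) ({y, z} : Finset Y)
    rw [Finset.coe_pair] at this
    exact this.trans Finset.card_le_two
  have hAQ : A.map R ≤ Submodule.span K {y, z} ⊓ LinearMap.ker ν := by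
    rintro _ ⟨f, hf, rfl⟩
    exact ⟨hAv f hf, hA hf v⟩
  have h1 := finrank_map_add_le R hA
  have h2 := Submodule.finrank_mono hAQ
  have h3 : finrank K (Submodule.span K {y, z} ⊓ LinearMap.ker ν : Submodule K Y) ≤
      finrank K (Submodule.span K ({y, z} : Set Y)) := Submodule.finrank_mono inf_le_left
  have hQ : Submodule.span K {y, z} ⊓ LinearMap.ker ν = Submodule.span K ({y, z} : Set Y) :=
    Submodule.eq_of_le_of_finrank_le inf_le_left (by omega)
  have hyQ : y ∈ Submodule.span K {y, z} ⊓ LinearMap.ker ν := by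
    rw [hQ]
    exact Submodule.subset_span (by simp)
  have hyv : e y v = 0 := hyQ.2
  refine ⟨by omega, fun w => mem_of_map_mem_of_finrank_le R hA hAQ (by omega)
    (wedgeForm_mem e w y) ?_⟩
  change e w v • y - e y v • w ∈ _
  rw [hyv, zero_smul, sub_zero]
  exact Submodule.smul_mem _ _ hyQ

theorem IsRangeCompatible.isLocalMap_alternatingAlong [FiniteDimensional K U] :
    ∀ (n : ℕ) {V Y : Type*} [AddCommGroup V] [Module K V] [AddCommGroup Y] [Module K Y],
      finrank K V = n + 3 → ∀ (e : Y ≃ₗ[K] Dual K V) {j : V →ₗ[K] U}, Function.Injective j →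
      ∀ {S : Submodule K (U →ₗ[K] Y)}, S ≤ alternatingAlong e j →
      finrank K (alternatingAlong e j) + 2 ≤ finrank K S + finrank K V →
      finrank K (alternatingAlong e (LinearMap.id (M := V))) + 3 ≤
        finrank K (S.map (LinearMap.lcomp K Y j)) + finrank K V →
      ∀ {F : S →+ Y}, IsRangeCompatible S F → IsLocalMap S F := by
  intro n
  induction n with
  | zero =>
    intro V Y _ _ _ _ hV e j hj S hSL hdim hdimr F hF
    have : FiniteDimensional K V := FiniteDimensional.of_finrank_pos (by omega)
    have : FiniteDimensional K Y := Module.Finite.equiv e.symm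
    exact hF.isLocalMap_alternatingAlong_of_finrank_eq_three (by omega) e hj hSL (by omega)
      (Submodule.eq_of_le_of_finrank_le (map_alternatingAlong_le hSL) (by omega))
  | succ n ih =>
    intro V Y _ _ _ _ hV e j hj S hSL hdim hdimr F hF
    have : FiniteDimensional K V := FiniteDimensional.of_finrank_pos (by omega)
    have : FiniteDimensional K Y := Module.Finite.equiv e.symm
    have hY : finrank K Y = finrank K V := by rw [e.finrank_eq, Subspace.dual_finrank_eq]
    have hSr := map_alternatingAlong_le hSL
    obtain ⟨B₁, hB₁top, hB₁⟩ : ∃ B : Submodule K Y, B ≠ ⊤ ∧ ∀ y ∉ B,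
        finrank K (alternatingAlong e j) + 3 ≤ finrank K S + finrank K V ∨
          y ∉ tensorFiber (LinearMap.range j) S := by
      by_cases h : finrank K (alternatingAlong e j) + 3 ≤ finrank K S + finrank K V
      · refine ⟨⊥, ?_, fun _ _ => Or.inl h⟩
        intro hbot
        have h0 := finrank_bot K Y
        rw [hbot, finrank_top] at h0
        omega
      · refine ⟨tensorFiber (LinearMap.range j) S, fun ht => h ?_, fun y hy => Or.inr hy⟩
        -- If `S` contains all maps vanishing on `V`, its codimension is that of `S_r`, at most `dim
        -- V - 3`, so the bound on `S` was not sharp.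
        have hle := vanishingOn_le_of_tensorFiber_eq_top ht
        have h0 : alternatingAlong e j ⊓ LinearMap.ker (LinearMap.lcomp K Y j) ≤
            S ⊓ LinearMap.ker (LinearMap.lcomp K Y j) := by
          refine le_inf ?_ inf_le_right
          rw [← vanishingOn_range_eq]
          exact hle
        have h1 := Submodule.finrank_mono h0
        have h2 := finrank_map_add_finrank_inf_ker (LinearMap.lcomp K Y j) S
        have h3 := finrank_map_add_finrank_inf_ker (LinearMap.lcomp K Y j) (alternatingAlong e j)
        have h4 := Submodule.finrank_mono
          (map_alternatingAlong_le (le_refl (alternatingAlong e j)))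
        omega
    -- Properness of `B₂ + K y`, and not only of `B₂`, lets `z` avoid `B₁`, `B₂` and `K y` as just
    -- two proper subspaces.
    obtain ⟨B₂, hB₂top, hB₂⟩ : ∃ B : Submodule K Y, (∀ y, B ⊔ K ∙ y ≠ ⊤) ∧ ∀ y ∉ B,
        finrank K (alternatingAlong e (LinearMap.id (M := V))) + 4 ≤
          finrank K (S.map (LinearMap.lcomp K Y j)) + finrank K V ∨
          y ∉ wedgeFiber e (S.map (LinearMap.lcomp K Y j)) := by
      by_cases h : finrank K (alternatingAlong e (LinearMap.id (M := V))) + 4 ≤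
          finrank K (S.map (LinearMap.lcomp K Y j)) + finrank K V
      · exact ⟨⊥, fun y => span_singleton_sup_ne_top_of_finrank (by rw [finrank_bot]; omega),
          fun _ _ => Or.inl h⟩
      · refine ⟨wedgeFiber e (S.map (LinearMap.lcomp K Y j)), fun y ht => h ?_,
          fun y hy => Or.inr hy⟩
        have := Submodule.finrank_mono (alternatingAlong_id_le_of_wedgeFiber_sup_eq_top ht)
        omega
    have hmod : ∀ y ∉ B₁, y ∉ B₂ → ∃ x : U, ∀ s : S, F s - (s : U →ₗ[K] Y) x ∈ K ∙ y := by
      intro y hy₁ hy₂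
      have hy : y ≠ 0 := fun h => hy₁ (h ▸ B₁.zero_mem)
      obtain ⟨F', hF', hFF'⟩ := hF.exists_map (K ∙ y).mkQ
      obtain ⟨e', he'⟩ := exists_quotient_pairing e y
      have hfr : finrank K (LinearMap.ker (e y)) = n + 3 := by
        have := Module.Dual.finrank_ker_add_one_of_ne_zero (f := e y) (by simpa using hy)
        omega
      obtain ⟨h1, h2, h3⟩ := finrank_add_le_of_map_quotient (d₁ := n + 3) (d₂ := n + 3)
        hj hSL hy ((hB₁ y hy₁).imp (fun h => by omega) fun h => ⟨by omega, h⟩)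
        ((hB₂ y hy₂).imp (fun h => by omega) fun h => ⟨by omega, h⟩) he' rfl rfl
      obtain ⟨x, hx⟩ := ih hfr e' (hj.comp (Submodule.subtype_injective _)) h1
        (by rw [hfr]; exact h2) (by rw [hfr]; exact h3) hF'
      refine ⟨x, fun s => ?_⟩
      rw [← Submodule.ker_mkQ (K ∙ y), LinearMap.mem_ker, map_sub, sub_eq_zero, ← hFF', hx]
      rfl
    have hB₂' : B₂ ≠ ⊤ := fun h => hB₂top 0 (by simp [h])
    obtain ⟨y, hy₁, hy₂⟩ := exists_notMem_notMem hB₁top hB₂'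
    obtain ⟨z, hz₁, hz₂⟩ := exists_notMem_notMem hB₁top (hB₂top y)
    have hzy : z ∉ K ∙ y := fun h => hz₂ (Submodule.mem_sup_right h)
    have hy0 : y ≠ 0 := fun h => hy₁ (h ▸ B₁.zero_mem)
    obtain ⟨x, hx⟩ := hmod y hy₁ hy₂
    obtain ⟨x', hx'⟩ := hmod z hz₁ fun h => hz₂ (Submodule.mem_sup_left h)
    obtain ⟨G, hG, hGF⟩ := hF.exists_sub x
    have h1 : ∀ s, G s ∈ K ∙ y := fun s => hGF s ▸ hx s
    have h2 : ∀ s : S, G s - (s : U →ₗ[K] Y) (x' - x) ∈ K ∙ z := by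
      intro s
      rw [hGF, map_sub]
      convert hx' s using 1
      abel
    by_cases hN : x' - x ∈ LinearMap.range j
    · obtain ⟨v, hv⟩ := hN
      by_cases hv0 : v = 0
      · refine ⟨x, fun s => ?_⟩
        obtain ⟨a, ha⟩ := Submodule.mem_span_singleton.1 (h1 s)
        obtain ⟨c, hc⟩ := Submodule.mem_span_singleton.1 (h2 s)
        rw [← hv, hv0, map_zero, map_zero, sub_zero] at hc
        have := smul_add_smul_eq_zero_of_notMem_span hy0 hzy (a := a) (b := -c) (by
          rw [neg_smul, ha, hc, add_neg_cancel])
        rw [← sub_eq_zero, ← hGF, ← ha, this.1, zero_smul]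
      · obtain ⟨h3, h4⟩ := mem_wedgeFiber_of_forall_apply_mem_span hSr hdimr hv0 (y := y)
          (z := z) (by
            rintro _ ⟨s, hs, rfl⟩
            obtain ⟨a, ha⟩ := Submodule.mem_span_singleton.1 (h1 ⟨s, hs⟩)
            obtain ⟨b, hb⟩ := Submodule.mem_span_singleton.1 (h2 ⟨s, hs⟩)
            refine Submodule.mem_span_pair.2 ⟨a, -b, ?_⟩
            rw [neg_smul, ha, hb, ← hv]
            simp)
        rcases hB₂ y hy₂ with h | h
        · omega
        · exact absurd h4 h
    · obtain ⟨φ, hφ, hφN⟩ := Submodule.exists_le_ker_of_notMem hN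
      refine (hG.false_of_two_lines hSL (by omega) (φ := (φ (x' - x))⁻¹ • φ)
        (inv_mul_cancel₀ hφ) ?_ hy0 hzy h1 h2).elim
      intro w v
      have : φ (j v) = 0 := hφN ⟨v, rfl⟩
      simp [this]

end Induction

/-! ### Transfer to the original statement -/

theorem relCodim_add_finrank {K U W : Type*} [Field K] [AddCommGroup U] [Module K U]
    [AddCommGroup W] [Module K W] [FiniteDimensional K U] [FiniteDimensional K W]
    {A B : Submodule K (U →ₗ[K] W)} (h : A ≤ B) :
    relCodim A B + finrank K A = finrank K B := by
  rw [relCodim, ← (Submodule.submoduleOfEquivOfLe h).finrank_eq]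
  exact Submodule.finrank_quotient_add_finrank _

theorem finrank_map_compRight {K U W W' : Type*} [Field K] [AddCommGroup U] [Module K U]
    [AddCommGroup W] [Module K W] [AddCommGroup W'] [Module K W'] (c : W ≃ₗ[K] W')
    (A : Submodule K (U →ₗ[K] W)) :
    finrank K (A.map (LinearMap.compRight K (M := U) c.toLinearMap)) = finrank K A :=
  (A.equivMapOfInjective _ fun _ _ h => LinearMap.ext fun u =>
    c.injective (LinearMap.congr_fun h u)).finrank_eq.symm

/-- Locality is invariant under an isomorphism of the target space. -/
theorem IsRangeCompatible.exists_conj {K U W W' : Type*} [Field K] [AddCommGroup U] [Module K U]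
    [AddCommGroup W] [Module K W] [AddCommGroup W'] [Module K W'] (c : W ≃ₗ[K] W')
    {S : Submodule K (U →ₗ[K] W)} {F : S →+ W} (hF : IsRangeCompatible S F)
    (h : ∀ F' : S.map (LinearMap.compRight K (M := U) c.toLinearMap) →+ W',
      IsRangeCompatible _ F' → IsLocalMap _ F') : IsLocalMap S F := by
  obtain ⟨F', hF', hFF'⟩ := hF.exists_map c.toLinearMap
  obtain ⟨x, hx⟩ := h F' hF'
  exact ⟨x, fun s => c.injective ((hFF' s).symm.trans (hx _))⟩

theorem mainTheorem4 {K U : Type*} [Field K] [AddCommGroup U] [Module K U]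
    [FiniteDimensional K U] (V : Submodule K U)
    (S : Submodule K (U →ₗ[K] Module.Dual K V)) (hS : S ≤ alternatingOperators V)
    (hcodim : relCodim S (alternatingOperators V) + 2 ≤ Module.finrank K V)
    (hcodim_r : relCodim (restrictedSpace V S) (alternatingForms K V) + 3 ≤ Module.finrank K V)
    (F : S →+ Module.Dual K V) (hF : IsRangeCompatible S F) :
    IsLocalMap S F := by
  -- Coordinates in the dual basis provide the space `Y`, with pairing `c.symm`; the dimensions of
  -- all the spaces involved are unchanged.
  let c : Dual K V ≃ₗ[K] (Fin (finrank K V) → K) := (finBasis K V).dualBasis.equivFun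
  have h1 : relCodim S (alternatingOperators V) + finrank K S =
      finrank K (alternatingOperators V) :=
    relCodim_add_finrank (W := Dual K V) hS
  have h2 : relCodim (restrictedSpace V S) (alternatingForms K V) +
      finrank K (restrictedSpace V S) = finrank K (alternatingForms K V) :=
    relCodim_add_finrank (W := Dual K V) (restrictedSpace_le V S hS)
  have e1 : alternatingAlong c.symm V.subtype =
      (alternatingOperators V).map (LinearMap.compRight K (M := U) c.toLinearMap) := by
    refine le_antisymm (fun f hf => ?_) ?_
    · exact ⟨c.symm.toLinearMap ∘ₗ f, hf, LinearMap.ext fun u => c.apply_symm_apply (f u)⟩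
    · rintro _ ⟨f, hf, rfl⟩ v
      exact (congrArg (fun φ : Dual K V => φ v) (c.symm_apply_apply (f v))).trans (hf v)
  have e2 : alternatingAlong c.symm (LinearMap.id (M := V)) =
      (alternatingForms K V).map (LinearMap.compRight K (M := V) c.toLinearMap) := by
    refine le_antisymm (fun f hf => ?_) ?_
    · exact ⟨c.symm.toLinearMap ∘ₗ f, hf, LinearMap.ext fun u => c.apply_symm_apply (f u)⟩
    · rintro _ ⟨f, hf, rfl⟩ v
      exact (congrArg (fun φ : Dual K V => φ v) (c.symm_apply_apply (f v))).trans (hf v)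
  have e3 : (S.map (LinearMap.compRight K (M := U) c.toLinearMap)).map
      (LinearMap.lcomp K _ V.subtype) =
      (restrictedSpace V S).map (LinearMap.compRight K (M := V) c.toLinearMap) := by
    rw [restrictedSpace, ← Submodule.map_comp, ← Submodule.map_comp]
    rfl
  have f0 : finrank K (S.map (LinearMap.compRight K (M := U) c.toLinearMap)) = finrank K S :=
    finrank_map_compRight (W := Dual K V) c S
  have f1 : finrank K (alternatingAlong c.symm V.subtype) =
      finrank K (alternatingOperators V) := by
    rw [e1]
    exact finrank_map_compRight (W := Dual K V) c _
  have f2 : finrank K (alternatingAlong c.symm (LinearMap.id (M := V))) =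
      finrank K (alternatingForms K V) := by
    rw [e2]
    exact finrank_map_compRight (W := Dual K V) c _
  have f3 : finrank K ((S.map (LinearMap.compRight K (M := U) c.toLinearMap)).map
      (LinearMap.lcomp K _ V.subtype)) = finrank K (restrictedSpace V S) := by
    rw [e3]
    exact finrank_map_compRight (W := Dual K V) c _
  refine IsRangeCompatible.exists_conj (W := Dual K V) c hF fun F' hF' => ?_
  refine IsRangeCompatible.isLocalMap_alternatingAlong (finrank K V - 3) (by omega) c.symm
    V.injective_subtype ?_ (by rw [f1, f0]; omega) (by rw [f2, f3]; omega) hF'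
  rw [e1]
  exact Submodule.map_mono hS
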